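/- Let $X$ be a complex vector space and, for each $n\in\mathbb N$, let $\mathcal O_n$ and $\mathcal W_n$ be norms on the space $\mathbb M_n(X)$ of $n\times n$ matrices over $X$. Matrices over $\mathbb C$ carry the operator norm. Suppose that $(X,\mathcal O_n)$ is an operator space, i.e. for all $m,n$, $x\in\mathbb M_m(X)$, $y\in\mathbb M_n(X)$, $\alpha\in\mathbb M_{n,m}(\mathbb C)$, $\beta\in\mathbb M_{m,n}(\mathbb C)$, $$\mathcal O_{m+n}\begin{pmatrix}x&0\\0&y\end{pmatrix}=\max\{\mathcal O_m(x),\mathcal O_n(y)\},\qquad \mathcal O_n(\alpha x\beta)\le\|\alpha\|\,\mathcal O_m(x)\,\|\beta\|,$$ and that $\mathcal W_n$ satisfies, for all such $m,n,x,y,\alpha$, $$\text{(WI)}\ \ \mathcal W_{m+n}\begin{pmatrix}x&0\\0&y\end{pmatrix}=\max\{\mathcal W_m(x),\mathcal W_n(y)\},\qquad \text{(WII)}\ \ \mathcal W_n(\alpha x\alpha^*)\le\|\alpha\|^2\,\mathcal W_m(x).$$ For $x\in\mathbb M_n(X)$ put $\mathcal W_{\min}(x)=\frac12\mathcal O_n(x)$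 and $$\mathcal W_{\max}(x)=\inf\tfrac12\|aa^*+b^*b\|,$$ where the infimum is over all $r\in\mathbb N$, $a\in\mathbb M_{n,r}(\mathbb C)$, $y\in\mathbb M_r(X)$, $b\in\mathbb M_{r,n}(\mathbb C)$ with $x=ayb$ and $\mathcal O_r(y)=1$ (if $X=0$, put $\mathcal W_{\max}=0$). For a Hilbert space $\mathcal H$ identify $\mathbb M_n(\mathbb B(\mathcal H))$ with $\mathbb B(\mathcal H^n)$, and let $\|\cdot\|_n$ and $w_n(T)=\sup\{|\langle T\xi,\xi\rangle| : \xi\in\mathcal H^n,\ \|\xi\|=1\}$ denote the operator norm and the numerical radius there (with $w_n=0$ if $\mathcal H^n=0$). Then the following are equivalent: (1) (OW) $\ \frac12\mathcal O_n(x)=\mathcal W_{2n}\begin{pmatrix}0&x\\0&0\end{pmatrix}$ for all $n\in\mathbb N$ and $x\in\mathbb M_n(X)$; (2) there exist a complex Hilbert space $\mathcal H$ and a linear map $\varPhi:X\to\mathbb B(\mathcal H)$ such that $\|[\varPhi(x_{ij})]\|_n=\mathcal O_n(x)$ and $w_n([\varPhi(x_{ij})])=\mathcal W_n(x)$ for all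 $n\in\mathbb N$ and $x=[x_{ij}]\in\mathbb M_n(X)$; (3) $\mathcal W_{\min}(x)\le\mathcal W_n(x)\le\mathcal W_{\max}(x)$ for all $n\in\mathbb N$ and $x\in\mathbb M_n(X)$. -/

import Mathlib

universe u

noncomputable section

/-- A (semi)norm on every matrix space `M_n(X)`, `n ∈ ℕ`. (The case `n = 0` is the zero space, on
which every seminorm is `0`, so it carries no information.) -/
abbrev MatrixSeminorms (X : Type u) [AddCommGroup X] [Module ℂ X] : Type u :=
  ∀ n : ℕ, Seminorm ℂ (Matrix (Fin n) (Fin n) X)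

/-- The `(m + n) × (m + n)` matrix `[x, 0; 0, y]`. -/
def diagSum {X : Type u} [AddCommGroup X] {m n : ℕ}
    (x : Matrix (Fin m) (Fin m) X) (y : Matrix (Fin n) (Fin n) X) :
    Matrix (Fin (m + n)) (Fin (m + n)) X :=
  Matrix.reindex finSumFinEquiv finSumFinEquiv (Matrix.fromBlocks x 0 0 y)

/-- The `2n × 2n` matrix `[0, x; 0, 0]`. -/
def upperCorner {X : Type u} [AddCommGroup X] {n : ℕ} (x : Matrix (Fin n) (Fin n) X) :
    Matrix (Fin (n + n)) (Fin (n + n)) X :=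
  Matrix.reindex finSumFinEquiv finSumFinEquiv (Matrix.fromBlocks 0 x 0 0)

/-- The product `a x b ∈ M_n(X)` of scalar matrices `a ∈ M_{n,m}(ℂ)`, `b ∈ M_{m,n}(ℂ)` with
`x ∈ M_m(X)`. -/
def sandwich {X : Type u} [AddCommGroup X] [Module ℂ X] {n m : ℕ}
    (a : Matrix (Fin n) (Fin m) ℂ) (x : Matrix (Fin m) (Fin m) X) (b : Matrix (Fin m) (Fin n) ℂ) :
    Matrix (Fin n) (Fin n) X :=
  fun i j => ∑ k, ∑ l, (a i k * b l j) • x k l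

section ScalarMatrices

-- Scalar matrices carry the operator norm between Euclidean spaces.
open scoped Matrix Matrix.Norms.L2Operator

/-- `(X, O_n)` is an (abstract) operator space: each `O_n` is a norm on `M_n(X)`, and Ruan's axioms
hold. -/
structure IsOperatorSpace {X : Type u} [AddCommGroup X] [Module ℂ X]
    (O : MatrixSeminorms X) : Prop where
  definite : ∀ (n : ℕ) (x : Matrix (Fin n) (Fin n) X), O n x = 0 → x = 0
  max_diagSum : ∀ (m n : ℕ) (x : Matrix (Fin m) (Fin m) X) (y : Matrix (Fin n) (Fin n) X),
    O (m + n) (diagSum x y) = max (O m x) (O n y)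
  sandwich_le : ∀ (m n : ℕ) (x : Matrix (Fin m) (Fin m) X)
    (α : Matrix (Fin n) (Fin m) ℂ) (β : Matrix (Fin m) (Fin n) ℂ),
    O n (sandwich α x β) ≤ ‖α‖ * O m x * ‖β‖

/-- `(X, W_n)` is an (abstract) numerical radius operator space: each `W_n` is a norm on `M_n(X)`,
and the axioms WI (`max_diagSum`) and WII (`conj_le`) hold. -/
structure IsNumericalRadiusOperatorSpace {X : Type u} [AddCommGroup X] [Module ℂ X]
    (W : MatrixSeminorms X) : Prop where
  definite : ∀ (n : ℕ) (x : Matrix (Fin n) (Fin n) X), W n x = 0 → x = 0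
  max_diagSum : ∀ (m n : ℕ) (x : Matrix (Fin m) (Fin m) X) (y : Matrix (Fin n) (Fin n) X),
    W (m + n) (diagSum x y) = max (W m x) (W n y)
  conj_le : ∀ (m n : ℕ) (x : Matrix (Fin m) (Fin m) X) (α : Matrix (Fin n) (Fin m) ℂ),
    W n (sandwich α x αᴴ) ≤ ‖α‖ ^ 2 * W m x

/-- `W_max(x) = inf ½‖a a* + b* b‖` over all factorizations `x = a y b` with `O(y) = 1`,
`y ∈ M_r(X)`, `r ∈ ℕ`. (If `X ≠ 0` such factorizations exist; if `X = 0` the value is `0`.) -/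
def wMax {X : Type u} [AddCommGroup X] [Module ℂ X] (O : MatrixSeminorms X) {n : ℕ}
    (x : Matrix (Fin n) (Fin n) X) : ℝ :=
  sInf {c : ℝ | ∃ (r : ℕ) (a : Matrix (Fin n) (Fin r) ℂ) (y : Matrix (Fin r) (Fin r) X)
    (b : Matrix (Fin r) (Fin n) ℂ), x = sandwich a y b ∧ O r y = 1 ∧
      c = 1 / 2 * ‖a * aᴴ + bᴴ * b‖}

end ScalarMatrices

/-- `W_min(x) = ½ O(x)`. -/
def wMin {X : Type u} [AddCommGroup X] [Module ℂ X] (O : MatrixSeminorms X) {n : ℕ}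
    (x : Matrix (Fin n) (Fin n) X) : ℝ :=
  1 / 2 * O n x

/-- Condition (OW): `½ O_n(x) = W_{2n}([0, x; 0, 0])` for all `x ∈ M_n(X)`, `n ∈ ℕ`. -/
def ConditionOW {X : Type u} [AddCommGroup X] [Module ℂ X] (O W : MatrixSeminorms X) : Prop :=
  ∀ (n : ℕ) (x : Matrix (Fin n) (Fin n) X), 1 / 2 * O n x = W (n + n) (upperCorner x)

section Hilbert

variable {H : Type u} [NormedAddCommGroup H] [InnerProductSpace ℂ H]

/-- The identification `M_n(B(H)) = B(Hⁿ)`, where `Hⁿ` is the Hilbert space direct sum: the matrix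
`[T_ij]` acts by `(T ξ)_i = ∑_j T_ij ξ_j`. -/
def matrixOperator {n : ℕ} (T : Matrix (Fin n) (Fin n) (H →L[ℂ] H)) :
    PiLp 2 (fun _ : Fin n => H) →L[ℂ] PiLp 2 (fun _ : Fin n => H) :=
  (PiLp.continuousLinearEquiv 2 ℂ (fun _ : Fin n => H)).symm.toContinuousLinearMap.comp
    (ContinuousLinearMap.pi fun i =>
      ∑ j, (T i j).comp (PiLp.proj 2 (𝕜 := ℂ) (fun _ : Fin n => H) j))

theorem matrixOperator_apply {n : ℕ} (T : Matrix (Fin n) (Fin n) (H →L[ℂ] H))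
    (ξ : PiLp 2 (fun _ : Fin n => H)) (i : Fin n) :
    matrixOperator T ξ i = ∑ j, T i j (ξ j) := by
  simp [matrixOperator]

/-- The numerical radius `w(T) = sup {|⟨T ξ, ξ⟩| : ‖ξ‖ = 1}`. The set is bounded by `‖T‖`; it is
empty only on the zero space, where the value is `0`. -/
def numericalRadius (T : H →L[ℂ] H) : ℝ :=
  sSup {c : ℝ | ∃ ξ : H, ‖ξ‖ = 1 ∧ c = ‖inner ℂ ξ (T ξ)‖}

end Hilbert

/-- `Φ : X → B(H)` is a complete isometry for `O`: `‖Φ_n(x)‖ = O_n(x)` for all `x ∈ M_n(X)`. -/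
def IsCompleteIsometry {X : Type u} [AddCommGroup X] [Module ℂ X]
    {H : Type u} [NormedAddCommGroup H] [InnerProductSpace ℂ H]
    (O : MatrixSeminorms X) (Φ : X →ₗ[ℂ] (H →L[ℂ] H)) : Prop :=
  ∀ (n : ℕ) (x : Matrix (Fin n) (Fin n) X), ‖matrixOperator (x.map Φ)‖ = O n x

/-- `Φ : X → B(H)` is a `W`-complete isometry: `w(Φ_n(x)) = W_n(x)` for all `x ∈ M_n(X)`. -/
def IsWCompleteIsometry {X : Type u} [AddCommGroup X] [Module ℂ X]
    {H : Type u} [NormedAddCommGroup H] [InnerProductSpace ℂ H]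
    (W : MatrixSeminorms X) (Φ : X →ₗ[ℂ] (H →L[ℂ] H)) : Prop :=
  ∀ (n : ℕ) (x : Matrix (Fin n) (Fin n) X), numericalRadius (matrixOperator (x.map Φ)) = W n x

end

/-! The link between operator norms and numerical radii is the identity w([0, T; 0, 0]) = ½‖T‖
(`numericalRadius_upperCorner`). Given it, (OW) says that the norms O are determined by W. For (1) ⇒
(2) it therefore suffices to represent W alone by some Φ with w(Φ_n(x)) = W_n(x); (OW) then forces
‖Φ_n(x)‖ = O_n(x).

The representation of W (`exists_isWCompleteIsometry`) is a Ruan-type argument. Take a functional F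
on M_n(X) that norms x. The axioms WI and WII make the pairs (αα*, Re F(αyα*)) with W(y) ≤ 1 a
convex cone lying below the operator norm, so Hahn–Banach yields a positive functional p with
|F(αyα*)| ≤ p(αα*) W(y). Its density matrix ρ, perturbed to be invertible, is used to renormalize F
to a map φ : X → B(ℂⁿ) whose amplifications contract W into the numerical radius and nearly attain
W_n(x). The Hilbert space sum of all such φ is Φ.

For (2) ⇒ (3), the lower bound is ‖T‖ ≤ 2w(T). The upper bound writes ayb as the congruence of [0,
y; 0, 0] by the row [a b*], and applies WII and (OW). For (3) ⇒ (1), both bounds evaluated at [0, x;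
0, 0] equal ½O(x). -/

section

open scoped Matrix

/-! ### Block matrix identities and estimates for `wMax`. -/

section MatrixBlocks

variable {X : Type u} [AddCommGroup X]

/-- The row block matrix `[a b]`. -/
def hstack {R : Type*} {n r s : ℕ} (a : Matrix (Fin n) (Fin r) R) (b : Matrix (Fin n) (Fin s) R) :
    Matrix (Fin n) (Fin (r + s)) R :=
  fun i => Fin.append (a i) (b i)

theorem hstack_mul_conjTranspose {n r s : ℕ} (a : Matrix (Fin n) (Fin r) ℂ)
    (b : Matrix (Fin n) (Fin s) ℂ) : hstack a b * (hstack a b)ᴴ = a * aᴴ + b * bᴴ := by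
  ext i j
  simp [hstack, Matrix.mul_apply, Fin.sum_univ_add]

variable [Module ℂ X]

theorem sandwich_hstack_diagSum {n r s : ℕ} (a : Matrix (Fin n) (Fin r) ℂ)
    (b : Matrix (Fin n) (Fin s) ℂ) (x : Matrix (Fin r) (Fin r) X) (y : Matrix (Fin s) (Fin s) X) :
    sandwich (hstack a b) (diagSum x y) (hstack a b)ᴴ = sandwich a x aᴴ + sandwich b y bᴴ := by
  ext i j
  simp [sandwich, hstack, diagSum, Fin.sum_univ_add]

/-- The corner meets only the first block on the left and the second on the right, so `c` and `d`
are free. Taking `c = bᴴ`, `d = a` makes a y b a congruence, to which WII applies. -/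
theorem sandwich_hstack_upperCorner {n r : ℕ} (a c d : Matrix (Fin n) (Fin r) ℂ)
    (b : Matrix (Fin r) (Fin n) ℂ) (y : Matrix (Fin r) (Fin r) X) :
    sandwich (hstack a c) (upperCorner y) (hstack d bᴴ)ᴴ = sandwich a y b := by
  ext i j
  simp [sandwich, hstack, upperCorner, Fin.sum_univ_add, -Fin.natAdd_eq_addNat]

theorem sandwich_one_one {n : ℕ} (x : Matrix (Fin n) (Fin n) X) : sandwich 1 x 1 = x := by
  ext i j
  simp [sandwich, Matrix.one_apply]

theorem upperCorner_eq_sandwich {n : ℕ} (x : Matrix (Fin n) (Fin n) X) :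
    upperCorner x = sandwich (hstack (1 : Matrix (Fin n) (Fin n) ℂ) 0)ᴴ x (hstack 0 1) := by
  ext i j
  refine Fin.addCases (fun i => ?_) (fun i => ?_) i <;>
    refine Fin.addCases (fun j => ?_) (fun j => ?_) j <;>
    simp [sandwich, hstack, upperCorner, Matrix.one_apply, -Fin.natAdd_eq_addNat]

theorem sandwich_smul_smul {n m : ℕ} (c d : ℂ) (a : Matrix (Fin n) (Fin m) ℂ)
    (x : Matrix (Fin m) (Fin m) X) (b : Matrix (Fin m) (Fin n) ℂ) :
    sandwich (c • a) x (d • b) = sandwich a ((c * d) • x) b := by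
  ext i j
  simp only [sandwich, Matrix.smul_apply, smul_smul, smul_eq_mul]
  refine Finset.sum_congr rfl fun k _ => Finset.sum_congr rfl fun l _ => ?_
  ring_nf

theorem sandwich_smul_middle {n m : ℕ} (c : ℂ) (a : Matrix (Fin n) (Fin m) ℂ)
    (x : Matrix (Fin m) (Fin m) X) (b : Matrix (Fin m) (Fin n) ℂ) :
    sandwich a (c • x) b = c • sandwich a x b := by
  ext i j
  simp only [sandwich, Matrix.smul_apply, smul_smul, Finset.smul_sum, mul_comm c]

theorem hstack_zero_one_conjTranspose_mul {n : ℕ} :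
    (hstack (1 : Matrix (Fin n) (Fin n) ℂ) (0 : Matrix (Fin n) (Fin n) ℂ))ᴴ *
        hstack (1 : Matrix (Fin n) (Fin n) ℂ) (0 : Matrix (Fin n) (Fin n) ℂ) +
      (hstack (0 : Matrix (Fin n) (Fin n) ℂ) (1 : Matrix (Fin n) (Fin n) ℂ))ᴴ *
        hstack (0 : Matrix (Fin n) (Fin n) ℂ) (1 : Matrix (Fin n) (Fin n) ℂ) = 1 := by
  ext i j
  refine Fin.addCases (fun i => ?_) (fun i => ?_) i <;>
    refine Fin.addCases (fun j => ?_) (fun j => ?_) j <;>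
    simp only [hstack, Matrix.add_apply, Matrix.mul_apply, Matrix.conjTranspose_apply,
      Fin.append_left, Fin.append_right, Matrix.one_apply, Matrix.zero_apply, Fin.ext_iff,
      Fin.val_castAdd, Fin.val_natAdd] <;>
    simp [← Fin.ext_iff, eq_comm] <;> omega

open scoped Matrix.Norms.L2Operator

/-- Only an inequality, because the norm is 0 when `n = 0`. -/
theorem norm_one_le {n : ℕ} : ‖(1 : Matrix (Fin n) (Fin n) ℂ)‖ ≤ 1 := by
  cases n with
  | zero => simp [Matrix.l2_opNorm_def]
  | succ n => exact norm_one.le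

theorem norm_sq_eq_norm_mul_conjTranspose {n m : ℕ} (a : Matrix (Fin n) (Fin m) ℂ) :
    ‖a‖ ^ 2 = ‖a * aᴴ‖ := by
  have := Matrix.l2_opNorm_conjTranspose_mul_self aᴴ
  rw [Matrix.conjTranspose_conjTranspose, Matrix.l2_opNorm_conjTranspose] at this
  rw [this, sq]

theorem norm_le_one_of_mul_conjTranspose_eq_one {n m : ℕ} {a : Matrix (Fin n) (Fin m) ℂ}
    (h : a * aᴴ = 1) : ‖a‖ ≤ 1 := by
  have := norm_sq_eq_norm_mul_conjTranspose a
  rw [h] at this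
  nlinarith [norm_nonneg a, norm_one_le (n := n)]

theorem norm_hstack_one_zero_le {n : ℕ} :
    ‖hstack (1 : Matrix (Fin n) (Fin n) ℂ) (0 : Matrix (Fin n) (Fin n) ℂ)‖ ≤ 1 :=
  norm_le_one_of_mul_conjTranspose_eq_one (by simp [hstack_mul_conjTranspose])

theorem norm_hstack_zero_one_le {n : ℕ} :
    ‖hstack (0 : Matrix (Fin n) (Fin n) ℂ) (1 : Matrix (Fin n) (Fin n) ℂ)‖ ≤ 1 :=
  norm_le_one_of_mul_conjTranspose_eq_one (by simp [hstack_mul_conjTranspose])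

theorem IsOperatorSpace.le_upperCorner {O : MatrixSeminorms X} (hO : IsOperatorSpace O) {n : ℕ}
    (x : Matrix (Fin n) (Fin n) X) : O n x ≤ O (n + n) (upperCorner x) := by
  have h := hO.sandwich_le _ _ (upperCorner x)
    (hstack (1 : Matrix (Fin n) (Fin n) ℂ) (0 : Matrix (Fin n) (Fin n) ℂ))
    (hstack (0 : Matrix (Fin n) (Fin n) ℂ) (1 : Matrix (Fin n) (Fin n) ℂ)ᴴ)ᴴ
  rw [sandwich_hstack_upperCorner, sandwich_one_one, Matrix.l2_opNorm_conjTranspose,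
    Matrix.conjTranspose_one] at h
  refine h.trans ?_
  have h0 := apply_nonneg (O (n + n)) (upperCorner x)
  calc _ ≤ 1 * O (n + n) (upperCorner x) * 1 := by
        gcongr
        · exact norm_hstack_one_zero_le
        · exact norm_hstack_zero_one_le
    _ = _ := by ring

theorem wMax_nonneg (O : MatrixSeminorms X) {n : ℕ} (x : Matrix (Fin n) (Fin n) X) :
    0 ≤ wMax O x :=
  Real.sInf_nonneg fun c ⟨_, _, _, _, _, _, hc⟩ => hc ▸ by positivity

theorem wMax_le_of_factorization (O : MatrixSeminorms X) {n r : ℕ} (a : Matrix (Fin n) (Fin r) ℂ)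
    (y : Matrix (Fin r) (Fin r) X) (b : Matrix (Fin r) (Fin n) ℂ) (hy : O r y = 1) :
    wMax O (sandwich a y b) ≤ 1 / 2 * ‖a * aᴴ + bᴴ * b‖ :=
  csInf_le ⟨0, fun c ⟨_, _, _, _, _, _, hc⟩ => hc ▸ by positivity⟩ ⟨r, a, y, b, rfl, hy, rfl⟩

theorem seminorm_inv_smul_self {n : ℕ} (p : Seminorm ℂ (Matrix (Fin n) (Fin n) X))
    {x : Matrix (Fin n) (Fin n) X} (hx : p x ≠ 0) : p (((p x : ℂ))⁻¹ • x) = 1 := by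
  rw [map_smul_eq_mul, norm_inv, Complex.norm_real, Real.norm_of_nonneg (apply_nonneg p x),
    inv_mul_cancel₀ hx]

/-- With t = O(x), factor the corner as √t[1 0]* · (x/t) · √t[0 1]. The two ranges are
complementary, so aa* + b*b = t·1. -/
theorem wMax_upperCorner_le {O : MatrixSeminorms X} {n : ℕ}
    {x : Matrix (Fin n) (Fin n) X} (hx : O n x ≠ 0) : wMax O (upperCorner x) ≤ 1 / 2 * O n x := by
  have h0 := apply_nonneg (O n) x
  set c : ℂ := ((√(O n x) : ℝ) : ℂ) with hc
  have hcc : c * c = (O n x : ℂ) := by rw [hc, ← Complex.ofReal_mul, Real.mul_self_sqrt h0]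
  have hx' : (O n x : ℂ) ≠ 0 := by exact_mod_cast hx
  have key := wMax_le_of_factorization O (c • (hstack (1 : Matrix (Fin n) (Fin n) ℂ) (0 : Matrix (Fin n) (Fin n) ℂ))ᴴ) ((O n x : ℂ)⁻¹ • x)
    (c • hstack (0 : Matrix (Fin n) (Fin n) ℂ) (1 : Matrix (Fin n) (Fin n) ℂ))
    (seminorm_inv_smul_self _ hx)
  rw [sandwich_smul_smul, smul_smul, hcc, mul_inv_cancel₀ hx', one_smul,
    ← upperCorner_eq_sandwich] at key
  refine key.trans ?_
  have hstar : star c = c := by simp [hc]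
  rw [Matrix.conjTranspose_smul, Matrix.conjTranspose_smul, Matrix.conjTranspose_conjTranspose,
    hstar, Matrix.smul_mul, Matrix.mul_smul, Matrix.smul_mul, Matrix.mul_smul, smul_smul, smul_smul,
    hcc, ← smul_add,
    hstack_zero_one_conjTranspose_mul, norm_smul, Complex.norm_real, Real.norm_of_nonneg h0]
  gcongr
  exact mul_le_of_le_one_right h0 norm_one_le

theorem le_wMax_of_conditionOW {O W : MatrixSeminorms X} (hO : IsOperatorSpace O)
    (hW : IsNumericalRadiusOperatorSpace W) (hOW : ConditionOW O W) {n : ℕ}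
    (x : Matrix (Fin n) (Fin n) X) : W n x ≤ wMax O x := by
  -- If X = 0 there is no factorization and the infimum takes its default value 0; nonnegativity of
  -- `wMax` is enough here.
  rcases eq_or_ne x 0 with rfl | hx
  · simpa using wMax_nonneg O 0
  have hOx : O n x ≠ 0 := fun h => hx (hO.definite n x h)
  have hx' : (O n x : ℂ) ≠ 0 := by exact_mod_cast hOx
  -- The trivial factorization x = (t1)(x/t)1 with t = O(x) shows that the set is nonempty.
  refine le_csInf ⟨_, n, (O n x : ℂ) • 1, (O n x : ℂ)⁻¹ • x, (1 : ℂ) • 1, ?_,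
    seminorm_inv_smul_self _ hOx, rfl⟩ ?_
  · rw [sandwich_smul_smul, mul_one, smul_smul, mul_inv_cancel₀ hx', one_smul, sandwich_one_one]
  · rintro c ⟨r, a, y, b, rfl, hy, rfl⟩
    have h := hW.conj_le _ _ (upperCorner y) (hstack a bᴴ)
    rwa [sandwich_hstack_upperCorner, norm_sq_eq_norm_mul_conjTranspose, hstack_mul_conjTranspose,
      Matrix.conjTranspose_conjTranspose, ← hOW, hy, mul_one, mul_comm] at h

end MatrixBlocks

/-! ### Numerical radius against operator norm. -/

section NumericalRadius

variable {H : Type u} [NormedAddCommGroup H] [InnerProductSpace ℂ H]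

theorem norm_inner_le_numericalRadius (T : H →L[ℂ] H) (ξ : H) :
    ‖inner ℂ ξ (T ξ)‖ ≤ numericalRadius T * ‖ξ‖ ^ 2 := by
  rcases eq_or_ne ξ 0 with rfl | hξ
  · simp
  have hn : ‖ξ‖ ≠ 0 := norm_ne_zero_iff.mpr hξ
  have hbdd : BddAbove {c : ℝ | ∃ ξ : H, ‖ξ‖ = 1 ∧ c = ‖inner ℂ ξ (T ξ)‖} := by
    refine ⟨‖T‖, ?_⟩
    rintro c ⟨η, hη, rfl⟩
    refine (norm_inner_le_norm _ _).trans ?_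
    simpa [hη] using T.le_opNorm η
  have h := le_csSup hbdd ⟨((‖ξ‖ : ℂ)⁻¹) • ξ, by simp [norm_smul, hn], rfl⟩
  rw [map_smul, inner_smul_left, inner_smul_right, norm_mul, norm_mul, RCLike.norm_conj, norm_inv,
    Complex.norm_real, norm_norm] at h
  have h2 : 0 < ‖ξ‖ ^ 2 := by positivity
  rw [← div_le_iff₀ h2]
  refine le_trans (le_of_eq ?_) h
  field_simp

theorem numericalRadius_le {T : H →L[ℂ] H} {c : ℝ} (hc : 0 ≤ c)
    (h : ∀ ξ, ‖inner ℂ ξ (T ξ)‖ ≤ c * ‖ξ‖ ^ 2) : numericalRadius T ≤ c := by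
  refine Real.sSup_le ?_ hc
  rintro _ ⟨ξ, hξ, rfl⟩
  simpa [hξ] using h ξ

theorem numericalRadius_nonneg (T : H →L[ℂ] H) : 0 ≤ numericalRadius T :=
  Real.sSup_nonneg fun _ ⟨_, _, hc⟩ => hc ▸ norm_nonneg _

theorem opNorm_le_of_sesq {T : H →L[ℂ] H} {c : ℝ} (hc : 0 ≤ c)
    (h : ∀ x y, ‖inner ℂ x (T y)‖ ≤ c * (‖x‖ ^ 2 + ‖y‖ ^ 2)) : ‖T‖ ≤ 2 * c := by
  refine T.opNorm_le_bound (by positivity) fun y => ?_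
  rcases eq_or_ne y 0 with rfl | hy
  · simp
  rcases eq_or_ne (T y) 0 with hT | hT
  · rw [hT, norm_zero]; positivity
  have hy' : 0 < ‖y‖ := norm_pos_iff.mpr hy
  have hT' : 0 < ‖T y‖ := norm_pos_iff.mpr hT
  -- The left vector is parallel to T y and has the length of y, which makes both squares equal.
  have h1 := h (((‖y‖ / ‖T y‖ : ℝ) : ℂ) • T y) y
  rw [inner_smul_left, inner_self_eq_norm_sq_to_K, norm_smul, norm_mul, RCLike.norm_conj,
    Complex.norm_real, Real.norm_of_nonneg (by positivity), norm_pow] at h1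
  simp only [Complex.coe_algebraMap, Complex.norm_real, norm_norm] at h1
  have e1 : ‖y‖ / ‖T y‖ * ‖T y‖ ^ 2 = ‖y‖ * ‖T y‖ := by field_simp
  have e2 : ‖y‖ / ‖T y‖ * ‖T y‖ = ‖y‖ := by field_simp
  rw [e1, e2] at h1
  refine le_of_mul_le_mul_left ?_ hy'
  nlinarith

/-- Polarization writes 4⟨Tx, y⟩ through four values of the quadratic form, and the parallelogram
law sums the four squared norms to 4(‖x‖² + ‖y‖²). -/
theorem opNorm_le_of_norm_inner_le {T : H →L[ℂ] H} {c : ℝ} (hc : 0 ≤ c)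
    (h : ∀ ξ, ‖inner ℂ ξ (T ξ)‖ ≤ c * ‖ξ‖ ^ 2) : ‖T‖ ≤ 2 * c := by
  have h' : ∀ ξ, ‖inner ℂ (T ξ) ξ‖ ≤ c * ‖ξ‖ ^ 2 := fun ξ => by
    rw [norm_inner_symm]; exact h ξ
  have key : ∀ x y : H, ‖inner ℂ (T x) y‖ ≤ c * (‖x‖ ^ 2 + ‖y‖ ^ 2) := by
    intro x y
    have hpol := inner_map_polarization' (T : H →ₗ[ℂ] H) x y
    simp only [ContinuousLinearMap.coe_coe] at hpol
    have p1 := parallelogram_law_with_norm ℂ x y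
    have p2 := parallelogram_law_with_norm ℂ x (Complex.I • y)
    rw [norm_smul, Complex.norm_I, one_mul] at p2
    have h1 := h' (x + y)
    have h2 := h' (x - y)
    have h3 := h' (x + Complex.I • y)
    have h4 := h' (x - Complex.I • y)
    rw [hpol, norm_div]
    have e : ∀ a b d f : ℂ, ‖a - b - Complex.I * d + Complex.I * f‖ ≤ ‖a‖ + ‖b‖ + ‖d‖ + ‖f‖ := by
      intro a b d f
      refine (norm_add_le _ _).trans ?_
      rw [norm_mul, Complex.norm_I, one_mul]
      gcongr
      refine (norm_sub_le _ _).trans ?_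
      rw [norm_mul, Complex.norm_I, one_mul]
      gcongr
      exact norm_sub_le _ _
    have hn4 : ‖(4 : ℂ)‖ = 4 := by simp
    rw [hn4, div_le_iff₀ (by norm_num)]
    refine (e _ _ _ _).trans ?_
    nlinarith
  refine opNorm_le_of_sesq hc fun x y => ?_
  rw [norm_inner_symm, add_comm]
  exact key y x

end NumericalRadius

/-! ### The numerical radius of a corner. -/

section MatrixOperator

variable {H : Type u} [NormedAddCommGroup H] [InnerProductSpace ℂ H]

theorem inner_matrixOperator {n : ℕ} (T : Matrix (Fin n) (Fin n) (H →L[ℂ] H))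
    (ξ : PiLp 2 (fun _ : Fin n => H)) :
    inner ℂ ξ (matrixOperator T ξ) = ∑ k, ∑ l, inner ℂ (ξ k) (T k l (ξ l)) := by
  simp [PiLp.inner_apply, matrixOperator_apply, inner_sum]

/-- For ξ = (η, ζ) the quadratic form of the corner is ⟨η, Tζ⟩ and ‖ξ‖² = ‖η‖² + ‖ζ‖². One
inequality is 2‖η‖‖ζ‖ ≤ ‖η‖² + ‖ζ‖²; the other is `opNorm_le_of_sesq`. -/
theorem numericalRadius_upperCorner {n : ℕ} (T : Matrix (Fin n) (Fin n) (H →L[ℂ] H)) :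
    numericalRadius (matrixOperator (upperCorner T)) = 1 / 2 * ‖matrixOperator T‖ := by
  have hcorner : ∀ ξ : PiLp 2 (fun _ : Fin (n + n) => H),
      inner ℂ ξ (matrixOperator (upperCorner T) ξ) =
        inner ℂ (WithLp.toLp 2 fun i : Fin n => ξ (Fin.castAdd n i))
          (matrixOperator T (WithLp.toLp 2 fun i : Fin n => ξ (Fin.natAdd n i))) := by
    intro ξ
    simp [upperCorner, Fin.sum_univ_add, PiLp.inner_apply, matrixOperator_apply, inner_sum,
      -Fin.natAdd_eq_addNat]
  have hnorm : ∀ ξ : PiLp 2 (fun _ : Fin (n + n) => H), ‖ξ‖ ^ 2 =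
      ‖(WithLp.toLp 2 fun i : Fin n => ξ (Fin.castAdd n i) : PiLp 2 (fun _ : Fin n => H))‖ ^ 2 +
      ‖(WithLp.toLp 2 fun i : Fin n => ξ (Fin.natAdd n i) : PiLp 2 (fun _ : Fin n => H))‖ ^ 2 := by
    intro ξ
    simp [PiLp.norm_sq_eq_of_L2, Fin.sum_univ_add]
  apply le_antisymm
  · refine numericalRadius_le (by positivity) fun ξ => ?_
    rw [hcorner, hnorm]
    set η : PiLp 2 (fun _ : Fin n => H) := WithLp.toLp 2 fun i : Fin n => ξ (Fin.castAdd n i)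
    set ζ : PiLp 2 (fun _ : Fin n => H) := WithLp.toLp 2 fun i : Fin n => ξ (Fin.natAdd n i)
    have h1 := norm_inner_le_norm (𝕜 := ℂ) η (matrixOperator T ζ)
    have h2 := (matrixOperator T).le_opNorm ζ
    have h3 := mul_le_mul_of_nonneg_left h2 (norm_nonneg η)
    have h4 := mul_nonneg (norm_nonneg (matrixOperator T)) (sq_nonneg (‖η‖ - ‖ζ‖))
    nlinarith
  · set w := numericalRadius (matrixOperator (upperCorner T)) with hw
    have hw0 : 0 ≤ w := numericalRadius_nonneg _
    have key : ∀ η ζ : PiLp 2 (fun _ : Fin n => H),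
        ‖inner ℂ η (matrixOperator T ζ)‖ ≤ w * (‖η‖ ^ 2 + ‖ζ‖ ^ 2) := by
      intro η ζ
      have := norm_inner_le_numericalRadius (matrixOperator (upperCorner T))
        (WithLp.toLp 2 (Fin.append η ζ))
      rw [hcorner, hnorm] at this
      simpa [-Fin.natAdd_eq_addNat] using this
    have := opNorm_le_of_sesq hw0 key
    linarith

end MatrixOperator

/-- A Hahn–Banach sandwich theorem: a linear functional fits between a convex cone of lower bounds
and a seminorm dominating it. -/
theorem exists_linearMap_between {E : Type*} [AddCommGroup E] [Module ℝ E] (q : Seminorm ℝ E)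
    (C : PointedCone ℝ (E × ℝ)) (h : ∀ z ∈ C, z.2 ≤ q z.1) :
    ∃ p : E →ₗ[ℝ] ℝ, (∀ x, p x ≤ q x) ∧ ∀ z ∈ C, z.2 ≤ p z.1 := by
  -- This is the epigraph of q minus C. A functional g that is nonnegative on it and satisfies g(0,
  -- t) = t gives p(x) = -g(x, 0).
  let s : PointedCone ℝ (E × ℝ) :=
    { carrier := {z | ∃ c ∈ C, q (z.1 + c.1) ≤ c.2 + z.2}
      zero_mem' := ⟨0, C.zero_mem, by simp⟩
      add_mem' := by
        rintro z w ⟨c, hc, hz⟩ ⟨d, hd, hw⟩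
        refine ⟨c + d, C.add_mem hc hd, ?_⟩
        have := map_add_le_add q (z.1 + c.1) (w.1 + d.1)
        simp only [Prod.fst_add, Prod.snd_add]
        rw [add_add_add_comm]
        linarith
      smul_mem' := by
        rintro t z ⟨c, hc, hz⟩
        refine ⟨t • c, Submodule.smul_mem C t hc, ?_⟩
        have ht : (0 : ℝ) ≤ t := t.2
        have e1 : (t • z).1 + (t • c).1 = (t : ℝ) • (z.1 + c.1) := by
          rw [smul_add]; rfl
        have e2 : (t • c).2 + (t • z).2 = (t : ℝ) * (c.2 + z.2) := by
          rw [mul_add]; rfl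
        rw [e1, e2, map_smul_eq_mul, Real.norm_of_nonneg ht]
        exact mul_le_mul_of_nonneg_left hz ht }
  let f : (E × ℝ) →ₗ.[ℝ] ℝ :=
    ⟨LinearMap.range (LinearMap.inr ℝ E ℝ),
      (LinearMap.snd ℝ E ℝ).comp (LinearMap.range (LinearMap.inr ℝ E ℝ)).subtype⟩
  obtain ⟨g, hgf, hgs⟩ := riesz_extension s f
    (by
      rintro ⟨_, t, rfl⟩ ⟨c, hc, hz⟩
      have h1 := h c hc
      have h2 : q c.1 ≤ c.2 + t := by simpa using hz
      change 0 ≤ t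
      linarith)
    (by
      rintro ⟨x, t⟩
      exact ⟨⟨_, q x - t, rfl⟩, 0, C.zero_mem, by simp⟩)
  have hg0 : ∀ t : ℝ, g (0, t) = t := fun t => hgf ⟨_, t, rfl⟩
  have hg : ∀ x t, g (x, t) = g (x, 0) + t := fun x t => by
    conv_rhs => rw [← hg0 t, ← map_add]
    simp
  refine ⟨-g.comp (LinearMap.inl ℝ E ℝ), fun x => ?_, fun z hz => ?_⟩
  · have := hgs (x, q x) ⟨0, C.zero_mem, by simp⟩
    rw [hg] at this
    change -g (x, 0) ≤ q x
    linarith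
  · have := hgs (-z) ⟨z, hz, by simp⟩
    rw [map_neg, show z = (z.1, z.2) from rfl, hg] at this
    change z.2 ≤ -g (z.1, 0)
    linarith

/-! ### From a functional on M_n(X) to a dominating density matrix. -/

section Representation

open scoped ComplexOrder

variable {X : Type u} [AddCommGroup X] [Module ℂ X] {W : MatrixSeminorms X}

open scoped Matrix.Norms.L2Operator

/-- WI makes the set of pairs (αα*, Re F(αxα*)) with W(x) ≤ 1 closed under addition, and WII with
‖α‖² = ‖αα*‖ puts it below the norm. The functional p comes from the Hahn–Banach sandwich; taking x
= 0 gives its positivity. -/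
theorem exists_state_dominating (hW : IsNumericalRadiusOperatorSpace W) {n : ℕ}
    (F : Matrix (Fin n) (Fin n) X →ₗ[ℂ] ℂ) (hF : ∀ x, ‖F x‖ ≤ W n x) :
    ∃ p : Matrix (Fin n) (Fin n) ℂ →ₗ[ℝ] ℝ, (∀ A, p A ≤ ‖A‖) ∧
      (∀ (r : ℕ) (α : Matrix (Fin n) (Fin r) ℂ), 0 ≤ p (α * αᴴ)) ∧
      ∀ (r : ℕ) (α : Matrix (Fin n) (Fin r) ℂ) (x : Matrix (Fin r) (Fin r) X),
        ‖F (sandwich α x αᴴ)‖ ≤ p (α * αᴴ) * W r x := by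
  have hsz : ∀ (r : ℕ) (α : Matrix (Fin n) (Fin r) ℂ),
      sandwich α (0 : Matrix (Fin r) (Fin r) X) αᴴ = 0 := fun r α => by ext; simp [sandwich]
  let C : PointedCone ℝ (Matrix (Fin n) (Fin n) ℂ × ℝ) :=
    { carrier := {z | ∃ (r : ℕ) (α : Matrix (Fin n) (Fin r) ℂ) (x : Matrix (Fin r) (Fin r) X),
        W r x ≤ 1 ∧ z = (α * αᴴ, (F (sandwich α x αᴴ)).re)}
      zero_mem' := ⟨0, 0, 0, by simp, by rw [hsz]; simp; rfl⟩
      add_mem' := by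
        rintro _ _ ⟨r, α, x, hx, rfl⟩ ⟨s, β, y, hy, rfl⟩
        refine ⟨r + s, hstack α β, diagSum x y, ?_, ?_⟩
        · rw [hW.max_diagSum]; exact max_le hx hy
        · rw [sandwich_hstack_diagSum, hstack_mul_conjTranspose, map_add]; rfl
      smul_mem' := by
        rintro t _ ⟨r, α, x, hx, rfl⟩
        have ht : (0 : ℝ) ≤ t := t.2
        have hcc : ((√(t : ℝ) : ℝ) : ℂ) * ((√(t : ℝ) : ℝ) : ℂ) = ((t : ℝ) : ℂ) := by
          rw [← Complex.ofReal_mul, Real.mul_self_sqrt ht]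
        refine ⟨r, ((√(t : ℝ) : ℝ) : ℂ) • α, x, hx, ?_⟩
        have hs : star ((√(t : ℝ) : ℝ) : ℂ) = ((√(t : ℝ) : ℝ) : ℂ) := by simp
        rw [Matrix.conjTranspose_smul, hs, sandwich_smul_smul, Matrix.smul_mul,
          Matrix.mul_smul, smul_smul, hcc,
          sandwich_smul_middle, map_smul, smul_eq_mul, Complex.re_ofReal_mul]
        rfl }
  obtain ⟨p, hp, hpC⟩ := exists_linearMap_between
    ((normSeminorm ℂ (Matrix (Fin n) (Fin n) ℂ)).restrictScalars ℝ) C (by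
      rintro _ ⟨r, α, x, hx, rfl⟩
      change (F _).re ≤ ‖α * αᴴ‖
      calc (F (sandwich α x αᴴ)).re ≤ ‖F (sandwich α x αᴴ)‖ := Complex.re_le_norm _
        _ ≤ W n (sandwich α x αᴴ) := hF _
        _ ≤ ‖α‖ ^ 2 * W r x := hW.conj_le _ _ _ _
        _ ≤ ‖α‖ ^ 2 * 1 := by gcongr
        _ = ‖α * αᴴ‖ := by rw [mul_one, norm_sq_eq_norm_mul_conjTranspose])
  refine ⟨p, hp, fun r α => ?_, fun r α x => ?_⟩
  · simpa [hsz] using hpC _ ⟨r, α, 0, by simp, rfl⟩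
  rcases eq_or_ne x 0 with rfl | hx
  · simp [hsz]
  have hWx : W r x ≠ 0 := fun h => hx (hW.definite r x h)
  have hpos : 0 < W r x := lt_of_le_of_ne (apply_nonneg _ _) hWx.symm
  -- The cone controls only real parts; a phase turns this into control of the modulus.
  obtain ⟨u, hu, huF⟩ : ∃ u : ℂ, ‖u‖ = 1 ∧ u * F (sandwich α x αᴴ) = ‖F (sandwich α x αᴴ)‖ := by
    rcases eq_or_ne (F (sandwich α x αᴴ)) 0 with h0 | h0
    · exact ⟨1, by simp, by simp [h0]⟩
    · have hn : (‖F (sandwich α x αᴴ)‖ : ℂ) ≠ 0 := by simpa using h0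
      refine ⟨(starRingEnd ℂ) (F (sandwich α x αᴴ)) / ‖F (sandwich α x αᴴ)‖, ?_, ?_⟩
      · rw [norm_div, RCLike.norm_conj, Complex.norm_real, norm_norm, div_self (by simpa using h0)]
      · rw [div_mul_eq_mul_div, RCLike.conj_mul]
        field_simp
        rfl
  have h1 := hpC _ ⟨r, α, u • ((W r x : ℂ)⁻¹ • x),
    by rw [map_smul_eq_mul, hu, one_mul, seminorm_inv_smul_self _ hWx], rfl⟩
  simp only [sandwich_smul_middle, map_smul, smul_eq_mul] at h1
  rw [mul_left_comm, huF, ← Complex.ofReal_inv, ← Complex.ofReal_mul, Complex.ofReal_re,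
    inv_mul_le_iff₀ hpos, mul_comm] at h1
  exact h1

/-- Represents p by a matrix. The pairing is Σ A_ij ρ_ij, without a transpose, so α becomes the
entrywise conjugate `Vᴴᵀ`. -/
theorem exists_posDef_dominating (hW : IsNumericalRadiusOperatorSpace W) {n : ℕ}
    (F : Matrix (Fin n) (Fin n) X →ₗ[ℂ] ℂ) (hF : ∀ x, ‖F x‖ ≤ W n x) {ε : ℝ} (hε : 0 < ε) :
    ∃ ρ : Matrix (Fin n) (Fin n) ℂ, ρ.PosDef ∧ ρ.trace.re ≤ 1 + ε * n ∧
      ∀ (m : ℕ) (V : Matrix (Fin n) (Fin m) ℂ) (x : Matrix (Fin m) (Fin m) X),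
        ‖F (sandwich Vᴴᵀ x Vᵀ)‖ ≤ (Vᴴ * ρ * V).trace.re * W m x := by
  obtain ⟨p, hp1, hp0, hp⟩ := exists_state_dominating hW F hF
  let P : Module.Dual ℂ (Matrix (Fin n) (Fin n) ℂ) := Module.Dual.extendRCLike p
  have hP : ∀ A, (P A).re = p A := fun A => by
    exact Module.Dual.re_extendRCLike_apply (𝕜 := ℂ) p A
  let ρ₀ : Matrix (Fin n) (Fin n) ℂ := Matrix.of fun i j => P (Matrix.single i j 1)
  have hPρ : ∀ A, P A = ∑ i, ∑ j, A i j * ρ₀ i j := by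
    intro A
    conv_lhs => rw [Matrix.matrix_eq_sum_single A]
    simp only [map_sum]
    refine Finset.sum_congr rfl fun i _ => Finset.sum_congr rfl fun j _ => ?_
    rw [show Matrix.single i j (A i j) = A i j • Matrix.single i j (1 : ℂ) by simp, map_smul]
    rfl
  have htr : ∀ {m : ℕ} (V : Matrix (Fin n) (Fin m) ℂ),
      (Vᴴ * ρ₀ * V).trace.re = p (Vᴴᵀ * (Vᴴᵀ)ᴴ) := by
    intro m V
    rw [← hP, hPρ]
    congr 1
    simp only [Matrix.trace, Matrix.diag, Matrix.mul_apply, Finset.sum_mul]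
    simp only [Matrix.conjTranspose_apply, Matrix.transpose_apply, star_star]
    rw [Finset.sum_comm_cycle]
    refine Finset.sum_congr rfl fun i _ => ?_
    rw [Finset.sum_comm]
    refine Finset.sum_congr rfl fun j _ => Finset.sum_congr rfl fun k _ => ?_
    ring
  -- Since p is only real-linear, ρ₀ need not be Hermitian; its Hermitian part has the same real
  -- traces tr(V*ρV).
  let ρ₁ : Matrix (Fin n) (Fin n) ℂ := (1 / 2 : ℂ) • (ρ₀ + ρ₀ᴴ)
  have hρ₁ : ρ₁.IsHermitian := by
    simp [ρ₁, Matrix.IsHermitian, Matrix.conjTranspose_smul, add_comm]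
  have htr₁ : ∀ {m : ℕ} (V : Matrix (Fin n) (Fin m) ℂ),
      (Vᴴ * ρ₁ * V).trace.re = p (Vᴴᵀ * (Vᴴᵀ)ᴴ) := by
    intro m V
    have h1 : (Vᴴ * ρ₀ᴴ * V).trace.re = (Vᴴ * ρ₀ * V).trace.re := by
      rw [← Complex.conj_re, starRingEnd_apply, ← Matrix.trace_conjTranspose]
      simp [Matrix.conjTranspose_mul, Matrix.mul_assoc]
    have h2 : (Vᴴ * ρ₁ * V).trace =
        ((1 / 2 : ℝ) : ℂ) * ((Vᴴ * ρ₀ * V).trace + (Vᴴ * ρ₀ᴴ * V).trace) := by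
      simp [ρ₁, Matrix.mul_add, Matrix.add_mul, mul_add]
    rw [h2, Complex.re_ofReal_mul, Complex.add_re, h1, htr]
    ring
  have hpsd : ρ₁.PosSemidef := by
    refine Matrix.PosSemidef.of_dotProduct_mulVec_nonneg hρ₁ fun v => ?_
    rw [Complex.nonneg_iff]
    refine ⟨?_, ?_⟩
    · have := htr₁ (Matrix.replicateCol (Fin 1) v)
      have h2 : ((Matrix.replicateCol (Fin 1) v)ᴴ * ρ₁ * Matrix.replicateCol (Fin 1) v).trace =
          star v ⬝ᵥ (ρ₁ *ᵥ v) := by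
        rw [Matrix.mul_assoc]
        simp [Matrix.trace, Matrix.mul_apply, dotProduct, Matrix.mulVec]
      rw [← h2, this]
      exact hp0 _ _
    · exact (hρ₁.im_star_dotProduct_mulVec_self v).symm
  -- The shift gives invertibility, raises the trace by εn and preserves the domination.
  refine ⟨ρ₁ + (ε : ℂ) • 1, ?_, ?_, fun m V x => ?_⟩
  · exact Matrix.PosDef.posSemidef_add hpsd (Matrix.PosDef.one.smul (by exact_mod_cast hε))
  · have h1 := htr₁ (1 : Matrix (Fin n) (Fin n) ℂ)
    have h2 := hp1 1
    have h3 := norm_one_le (n := n)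
    simp at h1
    simp
    linarith
  · have hV : (Vᴴᵀ)ᴴ = Vᵀ := by ext; simp
    rw [← hV]
    refine (hp m Vᴴᵀ x).trans ?_
    rw [← htr₁]
    refine mul_le_mul_of_nonneg_right ?_ (apply_nonneg _ _)
    have h1 := (Matrix.posSemidef_conjTranspose_mul_self V).trace_nonneg
    rw [Complex.nonneg_iff] at h1
    have h2 : (Vᴴ * (ρ₁ + (ε : ℂ) • 1) * V).trace =
        (Vᴴ * ρ₁ * V).trace + (ε : ℂ) * (Vᴴ * V).trace := by
      simp [Matrix.mul_add, Matrix.add_mul]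
    rw [h2, Complex.add_re, Complex.re_ofReal_mul]
    nlinarith [h1.1]

end Representation

/-- A linear map `φ : X → B(H)` whose amplifications map the unit balls of the `W_m` to operators
of numerical radius at most `1`. -/
def IsNumericalRadiusContraction {X : Type u} [AddCommGroup X] [Module ℂ X]
    {H : Type*} [NormedAddCommGroup H] [InnerProductSpace ℂ H]
    (W : MatrixSeminorms X) (φ : X →ₗ[ℂ] (H →L[ℂ] H)) : Prop :=
  ∀ (m : ℕ) (x : Matrix (Fin m) (Fin m) X) (ξ : Fin m → H),
    ‖∑ k, ∑ l, inner ℂ (ξ k) (φ (x k l) (ξ l))‖ ≤ W m x * ∑ k, ‖ξ k‖ ^ 2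

/-! ### Nearly norming contractions into B(ℂⁿ). -/

section Representation

open scoped ComplexOrder MatrixOrder

theorem Matrix.PosDef.exists_conjTranspose_mul_self {n : ℕ} {ρ : Matrix (Fin n) (Fin n) ℂ}
    (hρ : ρ.PosDef) : ∃ S T : Matrix (Fin n) (Fin n) ℂ, ρ = Sᴴ * S ∧ T * S = 1 ∧ S * T = 1 := by
  obtain ⟨S, hS⟩ := CStarAlgebra.nonneg_iff_eq_star_mul_self.mp hρ.posSemidef.nonneg
  have hdet : IsUnit S.det := by
    have h := hρ.det_pos.ne'
    rw [hS, Matrix.det_mul] at h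
    exact (right_ne_zero_of_mul h).isUnit
  exact ⟨S, S⁻¹, hS, Matrix.nonsing_inv_mul S hdet, Matrix.mul_nonsing_inv S hdet⟩

theorem inner_toEuclideanCLM_eq {n m : ℕ} (M : Matrix (Fin n) (Fin n) ℂ)
    (ξ : Fin m → EuclideanSpace ℂ (Fin n)) (k l : Fin m) :
    inner ℂ (ξ k) (Matrix.toEuclideanCLM (𝕜 := ℂ) M (ξ l)) =
      ((Matrix.of fun i k => ξ k i)ᴴ * M * Matrix.of fun i k => ξ k i) k l := by
  rw [Matrix.mul_assoc]
  simp only [PiLp.inner_apply, Matrix.mul_apply, Matrix.ofLp_toEuclideanCLM, Matrix.mulVec,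
    dotProduct, RCLike.inner_apply, Matrix.conjTranspose_apply, Matrix.of_apply]
  exact Finset.sum_congr rfl fun i _ => mul_comm _ _

theorem sum_norm_sq_eq_trace {n m : ℕ} (ξ : Fin m → EuclideanSpace ℂ (Fin n)) :
    ∑ k, ‖ξ k‖ ^ 2 =
      ((Matrix.of fun i k => ξ k i)ᴴ * Matrix.of fun i k => ξ k i).trace.re := by
  simp [EuclideanSpace.norm_sq_eq, Matrix.trace, Matrix.mul_apply, Complex.conj_mul',
    ← Complex.ofReal_pow]

variable {X : Type u} [AddCommGroup X] [Module ℂ X] {W : MatrixSeminorms X}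

theorem map_sandwich {n m : ℕ} (F : Matrix (Fin n) (Fin n) X →ₗ[ℂ] ℂ)
    (a : Matrix (Fin n) (Fin m) ℂ) (x : Matrix (Fin m) (Fin m) X) (b : Matrix (Fin m) (Fin n) ℂ) :
    F (sandwich a x b) =
      ∑ k, ∑ l, (aᵀ * (Matrix.of fun i j => F (Matrix.single i j (x k l))) * bᵀ) k l := by
  have h : sandwich a x b =
      ∑ k, ∑ l, ∑ j, ∑ i, (a i k * b l j) • Matrix.single i j (x k l) := by
    ext i j
    simp [sandwich, Matrix.sum_apply, Matrix.single_apply, ite_and]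
  rw [h]
  simp only [map_sum, map_smul, Matrix.mul_apply, Finset.sum_mul, smul_eq_mul,
    Matrix.transpose_apply, Matrix.of_apply]
  refine Finset.sum_congr rfl fun k _ => Finset.sum_congr rfl fun l _ =>
    Finset.sum_congr rfl fun j _ => Finset.sum_congr rfl fun i _ => ?_
  ring

theorem exists_dual_eq_seminorm {E : Type*} [AddCommGroup E] [Module ℂ E] (p : Seminorm ℂ E)
    (x : E) : ∃ F : E →ₗ[ℂ] ℂ, (∀ y, ‖F y‖ ≤ p y) ∧ F x = p x := by
  rcases eq_or_ne x 0 with rfl | hx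
  · exact ⟨0, fun y => by simp, by simp⟩
  let f : Module.Dual ℂ (Submodule.span ℂ {x}) :=
    (p x : ℂ) • (LinearEquiv.toSpanNonzeroSingleton ℂ E x hx).symm.toLinearMap
  have hf : ∀ c : ℂ, f (LinearEquiv.toSpanNonzeroSingleton ℂ E x hx c) = p x * c := fun c => by
    simp only [f, LinearMap.smul_apply, LinearEquiv.coe_coe, LinearEquiv.symm_apply_apply,
      smul_eq_mul]
  obtain ⟨F, hF, hFp⟩ := Module.Dual.exists_extension_of_le_seminorm (p := p) _ f (by
    intro y
    obtain ⟨c, rfl⟩ := (LinearEquiv.toSpanNonzeroSingleton ℂ E x hx).surjective y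
    rw [hf, LinearEquiv.toSpanNonzeroSingleton_apply, map_smul_eq_mul, norm_mul, Complex.norm_real,
      Real.norm_of_nonneg (apply_nonneg p x), mul_comm])
  refine ⟨F, hFp, ?_⟩
  have h1 := hF (LinearEquiv.toSpanNonzeroSingleton ℂ E x hx 1)
  rw [hf] at h1
  simpa using h1

/-- With ρ = S*S and T = S⁻¹, put φ(y) = T*[F(E_ij ⊗ y)]T. If Ξ has columns ξ_k, the quadratic form
of φ is F evaluated on a congruence with V = TΞ, and tr(V*ρV) = tr(Ξ*Ξ) = Σ‖ξ_k‖². -/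
theorem exists_contraction_lt (hW : IsNumericalRadiusOperatorSpace W) {n : ℕ}
    (x : Matrix (Fin n) (Fin n) X) {c : ℝ} (hc0 : 0 ≤ c) (hc : c < W n x) :
    ∃ φ : X →ₗ[ℂ] (EuclideanSpace ℂ (Fin n) →L[ℂ] EuclideanSpace ℂ (Fin n)),
      IsNumericalRadiusContraction W φ ∧ ∃ ξ : Fin n → EuclideanSpace ℂ (Fin n),
        c * ∑ k, ‖ξ k‖ ^ 2 < ‖∑ k, ∑ l, inner ℂ (ξ k) (φ (x k l) (ξ l))‖ := by
  obtain ⟨F, hF, hFx⟩ := exists_dual_eq_seminorm (W n) x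
  obtain ⟨ε, hε, hcε⟩ : ∃ ε : ℝ, 0 < ε ∧ c * (1 + ε * n) < W n x := by
    have hd : 0 < c * n + 1 := by positivity
    refine ⟨(W n x - c) / (c * n + 1), div_pos (by linarith) hd, ?_⟩
    have : (W n x - c) / (c * n + 1) * (c * n) < W n x - c := by
      rw [div_mul_eq_mul_div, div_lt_iff₀ hd]
      nlinarith
    linarith
  obtain ⟨ρ, hρ, hρ1, hρF⟩ := exists_posDef_dominating hW F hF hε
  obtain ⟨S, T, hS, hTS, hST⟩ := hρ.exists_conjTranspose_mul_self
  let φ : X →ₗ[ℂ] (EuclideanSpace ℂ (Fin n) →L[ℂ] EuclideanSpace ℂ (Fin n)) :=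
    { toFun := fun y => Matrix.toEuclideanCLM (𝕜 := ℂ)
        (Tᴴ * (Matrix.of fun i j => F (Matrix.single i j y)) * T)
      map_add' := fun y z => by
        rw [← map_add, ← Matrix.add_mul, ← Matrix.mul_add]
        congr 3
        ext i j
        simp [Matrix.single_add]
      map_smul' := fun a y => by
        rw [RingHom.id_apply, ← map_smul, ← Matrix.smul_mul, ← Matrix.mul_smul]
        congr 3
        ext i j
        simp [← Matrix.smul_single] }
  have hφ : ∀ (m : ℕ) (y : Matrix (Fin m) (Fin m) X) (ξ : Fin m → EuclideanSpace ℂ (Fin n)),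
      ∑ k, ∑ l, inner ℂ (ξ k) (φ (y k l) (ξ l)) =
        F (sandwich (T * Matrix.of fun i k => ξ k i)ᴴᵀ y (T * Matrix.of fun i k => ξ k i)ᵀ) := by
    intro m y ξ
    rw [map_sandwich]
    refine Finset.sum_congr rfl fun k _ => Finset.sum_congr rfl fun l _ => ?_
    change inner ℂ (ξ k) (Matrix.toEuclideanCLM (𝕜 := ℂ) _ (ξ l)) = _
    rw [inner_toEuclideanCLM_eq]
    simp only [Matrix.transpose_transpose, Matrix.conjTranspose_mul, Matrix.mul_assoc]
  -- The test vectors are the columns of S: then V = TS = 1, the form equals F(x) = W_n(x), and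
  -- Σ‖ξ_k‖² = tr ρ ≤ 1 + εn.
  refine ⟨φ, fun m y ξ => ?_, fun k => WithLp.toLp 2 fun i => S i k, ?_⟩
  · rw [hφ, sum_norm_sq_eq_trace, mul_comm]
    refine (hρF m _ y).trans (le_of_eq ?_)
    congr 3
    generalize (Matrix.of fun i k => ξ k i : Matrix (Fin n) (Fin m) ℂ) = Ξ
    calc (T * Ξ)ᴴ * ρ * (T * Ξ) = Ξᴴ * ((S * T)ᴴ * (S * T)) * Ξ := by
          simp only [hS, Matrix.conjTranspose_mul, Matrix.mul_assoc]
      _ = Ξᴴ * Ξ := by simp [hST]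
  · rw [hφ, sum_norm_sq_eq_trace]
    have e : (Matrix.of fun i k => (WithLp.toLp 2 fun i => S i k : EuclideanSpace ℂ (Fin n)) i) =
      S := rfl
    rw [e, hTS, ← hS, Matrix.conjTranspose_one, Matrix.transpose_one, sandwich_one_one, hFx,
      Complex.norm_real, Real.norm_of_nonneg (apply_nonneg _ _)]
    exact (mul_le_mul_of_nonneg_left hρ1 hc0).trans_lt hcε

end Representation

/-! ### Block diagonal operators on Hilbert sums. -/

section DirectSum

variable {ι : Type*} {E : ι → Type*} [∀ i, NormedAddCommGroup (E i)]
  [∀ i, InnerProductSpace ℂ (E i)]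

theorem norm_apply_le_norm_smul (T : ∀ i, E i →L[ℂ] E i) {C : ℝ} (hT : ∀ i, ‖T i‖ ≤ C)
    (f : lp E 2) (i : ι) : ‖T i (f i)‖ ≤ ‖((C : ℂ) • f) i‖ := by
  rw [lp.coeFn_smul, Pi.smul_apply, norm_smul, Complex.norm_real]
  exact (T i).le_of_opNorm_le ((hT i).trans (le_abs_self C)) (f i)

/-- The block diagonal operator on a Hilbert space direct sum. -/
noncomputable def lpDiagonal (T : ∀ i, E i →L[ℂ] E i) (C : ℝ) (hT : ∀ i, ‖T i‖ ≤ C) : lp E 2 →L[ℂ] lp E 2 :=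
  LinearMap.mkContinuous
    { toFun := fun f => ⟨fun i => T i (f i),
        (lp.memℓp ((C : ℂ) • f)).mono' (norm_apply_le_norm_smul T hT f)⟩
      map_add' := fun f g => by ext i; simp; rfl
      map_smul' := fun c f => by ext i; simp } |C| fun f => by
    refine (lp.norm_mono two_ne_zero (y := (C : ℂ) • f)
      (norm_apply_le_norm_smul T hT f)).trans ?_
    rw [norm_smul, Complex.norm_real, Real.norm_eq_abs]

theorem lpDiagonal_apply (T : ∀ i, E i →L[ℂ] E i) (C : ℝ) (hT : ∀ i, ‖T i‖ ≤ C) (f : lp E 2)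
    (i : ι) : lpDiagonal T C hT f i = T i (f i) := rfl

end DirectSum

/-! ### Gluing the contractions into one representation. -/

section Representation

variable {X : Type u} [AddCommGroup X] [Module ℂ X] {W : MatrixSeminorms X}

/-- The case m = 1 combined with ‖T‖ ≤ 2w(T). The bound does not depend on φ, so direct sums of
contractions are bounded. -/
theorem IsNumericalRadiusContraction.opNorm_le {H : Type*} [NormedAddCommGroup H]
    [InnerProductSpace ℂ H] {φ : X →ₗ[ℂ] (H →L[ℂ] H)} (hφ : IsNumericalRadiusContraction W φ)
    (y : X) : ‖φ y‖ ≤ 2 * W 1 (Matrix.of fun _ _ => y) :=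
  opNorm_le_of_norm_inner_le (apply_nonneg _ _) fun ξ => by
    simpa using hφ 1 (Matrix.of fun _ _ => y) fun _ => ξ

theorem numericalRadius_matrixOperator_le {H : Type u} [NormedAddCommGroup H]
    [InnerProductSpace ℂ H] {φ : X →ₗ[ℂ] (H →L[ℂ] H)} (hφ : IsNumericalRadiusContraction W φ)
    {n : ℕ} (x : Matrix (Fin n) (Fin n) X) :
    numericalRadius (matrixOperator (x.map φ)) ≤ W n x :=
  numericalRadius_le (apply_nonneg _ _) fun ξ => by
    rw [inner_matrixOperator, PiLp.norm_sq_eq_of_L2]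
    exact hφ n x ξ

section Family

variable {ι : Type*} {E : ι → Type*} [∀ i, NormedAddCommGroup (E i)]
  [∀ i, InnerProductSpace ℂ (E i)]

/-- The direct sum of a family of numerical radius contractions. -/
noncomputable def contractionSum (φ : ∀ i, X →ₗ[ℂ] (E i →L[ℂ] E i))
    (hφ : ∀ i, IsNumericalRadiusContraction W (φ i)) : X →ₗ[ℂ] (lp E 2 →L[ℂ] lp E 2) where
  toFun y := lpDiagonal (fun i => φ i y) _ fun i => (hφ i).opNorm_le y
  map_add' y z := by ext f i; simp [lpDiagonal_apply]
  map_smul' c y := by ext f i; simp [lpDiagonal_apply]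

theorem contractionSum_apply (φ : ∀ i, X →ₗ[ℂ] (E i →L[ℂ] E i))
    (hφ : ∀ i, IsNumericalRadiusContraction W (φ i)) (y : X) (f : lp E 2) (i : ι) :
    contractionSum φ hφ y f i = φ i y (f i) := rfl

theorem isNumericalRadiusContraction_contractionSum (φ : ∀ i, X →ₗ[ℂ] (E i →L[ℂ] E i))
    (hφ : ∀ i, IsNumericalRadiusContraction W (φ i)) :
    IsNumericalRadiusContraction W (contractionSum φ hφ) := by
  intro m x ξ
  have h1 : HasSum (fun i => ∑ k, ∑ l, inner ℂ (ξ k i) (φ i (x k l) (ξ l i)))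
      (∑ k, ∑ l, inner ℂ (ξ k) (contractionSum φ hφ (x k l) (ξ l))) :=
    hasSum_sum fun k _ => hasSum_sum fun l _ => lp.hasSum_inner (ξ k) _
  have h2 : HasSum (fun i => W m x * ∑ k, ‖ξ k i‖ ^ 2) (W m x * ∑ k, ‖ξ k‖ ^ 2) := by
    refine (hasSum_sum fun k _ => ?_).mul_left _
    simpa using lp.hasSum_norm (p := 2) (by simp) (ξ k)
  exact h1.norm_le_of_bounded h2 fun i => hφ i m x fun k => ξ k i

/-- Test the direct sum on vectors supported in the i-th summand. -/
theorem norm_sum_inner_le_numericalRadius_contractionSum {ι : Type u} {E : ι → Type}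
    [∀ i, NormedAddCommGroup (E i)] [∀ i, InnerProductSpace ℂ (E i)]
    (φ : ∀ i, X →ₗ[ℂ] (E i →L[ℂ] E i)) (hφ : ∀ i, IsNumericalRadiusContraction W (φ i)) {n : ℕ}
    (x : Matrix (Fin n) (Fin n) X) (i : ι) (ξ : Fin n → E i) :
    ‖∑ k, ∑ l, inner ℂ (ξ k) (φ i (x k l) (ξ l))‖ ≤
      numericalRadius (matrixOperator (x.map (contractionSum φ hφ))) * ∑ k, ‖ξ k‖ ^ 2 := by
  classical
  have h := norm_inner_le_numericalRadius (matrixOperator (x.map (contractionSum φ hφ)))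
    (WithLp.toLp 2 fun k => lp.single 2 i (ξ k))
  rw [inner_matrixOperator, PiLp.norm_sq_eq_of_L2] at h
  simpa [lp.inner_single_left, contractionSum_apply, lp.norm_single] using h

theorem isWCompleteIsometry_contractionSum {ι : Type u} {E : ι → Type}
    [∀ i, NormedAddCommGroup (E i)] [∀ i, InnerProductSpace ℂ (E i)]
    (φ : ∀ i, X →ₗ[ℂ] (E i →L[ℂ] E i)) (hφ : ∀ i, IsNumericalRadiusContraction W (φ i))
    (h : ∀ (n : ℕ) (x : Matrix (Fin n) (Fin n) X) (c : ℝ), 0 ≤ c → c < W n x →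
      ∃ i, ∃ ξ : Fin n → E i,
        c * ∑ k, ‖ξ k‖ ^ 2 < ‖∑ k, ∑ l, inner ℂ (ξ k) (φ i (x k l) (ξ l))‖) :
    IsWCompleteIsometry W (contractionSum φ hφ) := fun n x => by
  refine le_antisymm
    (numericalRadius_matrixOperator_le (isNumericalRadiusContraction_contractionSum φ hφ) x)
    (le_of_forall_lt fun c hc => ?_)
  rcases lt_or_ge c 0 with hc0 | hc0
  · exact hc0.trans_le (numericalRadius_nonneg _)
  obtain ⟨i, ξ, hξ⟩ := h n x c hc0 hc
  exact lt_of_mul_lt_mul_right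
    (hξ.trans_le (norm_sum_inner_le_numericalRadius_contractionSum φ hφ x i ξ)) (by positivity)

end Family

/-- The numerical radius analogue of Ruan's representation theorem. -/
theorem exists_isWCompleteIsometry (hW : IsNumericalRadiusOperatorSpace W) :
    ∃ (H : Type u) (_ : NormedAddCommGroup H) (_ : InnerProductSpace ℂ H) (_ : CompleteSpace H)
      (Φ : X →ₗ[ℂ] (H →L[ℂ] H)), IsWCompleteIsometry W Φ := by
  -- Summing over all contractions on all ℂⁿ needs no choice of one for each x, and the index type
  -- stays in the universe of X.
  let ι : Type u := Σ n : ℕ,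
    {φ : X →ₗ[ℂ] (EuclideanSpace ℂ (Fin n) →L[ℂ] EuclideanSpace ℂ (Fin n)) //
      IsNumericalRadiusContraction W φ}
  exact ⟨lp (fun i : ι => EuclideanSpace ℂ (Fin i.1)) 2, inferInstance, inferInstance,
    inferInstance, _, isWCompleteIsometry_contractionSum (fun i : ι => i.2.1) (fun i => i.2.2)
      fun n x c hc0 hc =>
        let ⟨ψ, hψ, hξ⟩ := exists_contraction_lt hW x hc0 hc
        ⟨⟨n, ψ, hψ⟩, hξ⟩⟩

end Representation

/-! ### The implications between the three conditions. -/

section Equivalence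

variable {X : Type u} [AddCommGroup X] [Module ℂ X] {O W : MatrixSeminorms X}

theorem map_upperCorner {H : Type u} [NormedAddCommGroup H] [InnerProductSpace ℂ H]
    (Φ : X →ₗ[ℂ] (H →L[ℂ] H)) {n : ℕ} (x : Matrix (Fin n) (Fin n) X) :
    (upperCorner x).map Φ = upperCorner (x.map Φ) := by
  simp [upperCorner, Matrix.fromBlocks_map, Matrix.reindex_apply, ← Matrix.submatrix_map]

theorem conditionOW_of_completeIsometries {H : Type u} [NormedAddCommGroup H]
    [InnerProductSpace ℂ H] {Φ : X →ₗ[ℂ] (H →L[ℂ] H)} (hO : IsCompleteIsometry O Φ)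
    (hW : IsWCompleteIsometry W Φ) : ConditionOW O W := fun n x => by
  rw [← hO, ← hW, map_upperCorner, numericalRadius_upperCorner]

theorem isCompleteIsometry_of_conditionOW {H : Type u} [NormedAddCommGroup H]
    [InnerProductSpace ℂ H] {Φ : X →ₗ[ℂ] (H →L[ℂ] H)} (hOW : ConditionOW O W)
    (hW : IsWCompleteIsometry W Φ) : IsCompleteIsometry O Φ := fun n x => by
  have h := hOW n x
  rw [← hW, map_upperCorner, numericalRadius_upperCorner] at h
  linarith

theorem wMin_le_of_completeIsometries {H : Type u} [NormedAddCommGroup H]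
    [InnerProductSpace ℂ H] {Φ : X →ₗ[ℂ] (H →L[ℂ] H)} (hO : IsCompleteIsometry O Φ)
    (hW : IsWCompleteIsometry W Φ) {n : ℕ} (x : Matrix (Fin n) (Fin n) X) :
    wMin O x ≤ W n x := by
  have h := opNorm_le_of_norm_inner_le (numericalRadius_nonneg _)
    (norm_inner_le_numericalRadius (matrixOperator (x.map Φ)))
  rw [hO, hW] at h
  rw [wMin]
  linarith

/-- Apply the hypothesis to the corner: ½O(x) ≤ W_min ≤ W ≤ W_max ≤ ½O(x) there. The case O(x) = 0
is separate because the last bound rescales x by its norm. -/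
theorem conditionOW_of_wMin_le_of_le_wMax (hO : IsOperatorSpace O)
    (h : ∀ (n : ℕ) (x : Matrix (Fin n) (Fin n) X), wMin O x ≤ W n x ∧ W n x ≤ wMax O x) :
    ConditionOW O W := by
  intro n x
  have hmin := (h _ (upperCorner x)).1
  rw [wMin] at hmin
  refine le_antisymm ?_ ?_
  · linarith [hO.le_upperCorner x]
  · rcases eq_or_ne (O n x) 0 with h0 | h0
    · have hx : x = 0 := hO.definite n x h0
      have : upperCorner (0 : Matrix (Fin n) (Fin n) X) = 0 := by simp [upperCorner]
      simp [hx, this]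
    · exact (h _ (upperCorner x)).2.trans (wMax_upperCorner_le h0)

end Equivalence

end

theorem corollary3p3 {X : Type u} [AddCommGroup X] [Module ℂ X] (O W : MatrixSeminorms X)
    (hO : IsOperatorSpace O) (hW : IsNumericalRadiusOperatorSpace W) :
    List.TFAE [
      ConditionOW O W,
      ∃ (H : Type u) (_ : NormedAddCommGroup H) (_ : InnerProductSpace ℂ H) (_ : CompleteSpace H)
        (Φ : X →ₗ[ℂ] (H →L[ℂ] H)), IsCompleteIsometry O Φ ∧ IsWCompleteIsometry W Φ,
      ∀ (n : ℕ) (x : Matrix (Fin n) (Fin n) X), wMin O x ≤ W n x ∧ W n x ≤ wMax O x] := by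
  tfae_have 1 → 2 := fun h => by
    obtain ⟨H, i1, i2, i3, Φ, hΦ⟩ := exists_isWCompleteIsometry hW
    exact ⟨H, i1, i2, i3, Φ, isCompleteIsometry_of_conditionOW h hΦ, hΦ⟩
  tfae_have 2 → 3 := by
    rintro ⟨H, _, _, _, Φ, hΦO, hΦW⟩ n x
    exact ⟨wMin_le_of_completeIsometries hΦO hΦW x,
      le_wMax_of_conditionOW hO hW (conditionOW_of_completeIsometries hΦO hΦW) x⟩
  tfae_have 3 → 1 := conditionOW_of_wMin_le_of_le_wMax hO
  tfae_finish
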